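/- **Setting.** Consider a cellular embedding of the complete graph $K_n$ in an oriented closed surface. Assume that it is circular (every face is bounded by a cycle, so a facial walk repeats no vertex) and self-dual (the dual graph, a multigraph on the faces, is isomorphic to $K_n$). For an arc $(a,b)$ (an ordered pair of distinct vertices, with tail $a$) let $f_{ab}$ be the unique face whose facial walk contains $(a,b)$. Let $M$ be the arc-face incidence matrix and $N$ the arc-tail incidence matrix, let $\widehat M,\widehat N$ be obtained by scaling each column to a unit vector, and let $$U=(2\widehat M\widehat M^{T}-I)(2\widehat N\widehat N^{T}-I)$$ be the transition matrix of the vertex-face walk. The principal Hamiltonian of $U$ is the Hermitian matrix $H$ with $U=\exp(iH)$ and all eigenvalues in $(-\pi,\pi]$. If $H=iS$ with $S$ real and skew-symmetric, the $H$-digraph of $U$ is the weighted oriented graph on the arcs of $K_n$ with skew-adjacency matrix $S$; here an arc from $x$ to $y$ of weight $w>0$ contributes $S_{y,x}=w$ and $S_{x,y}=-w$. The line digraph $LD(K_n)$ has the arcs of $K_n$ as vertices, with an arc from $(a,b)$ to $(c,d)$ if and only if $b=c$. Its skew-adjacency matrix (same convention) is the sum of the contributions of its arcs with $w=1$, so that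 pairs of opposite arcs, $(a,b)\to(b,a)$ and $(b,a)\to(a,b)$, cancel; accordingly its oriented graph $LD^{\circ}(K_n)$ is $LD(K_n)$ without these pairs of opposite arcs. **Theorem.** The principal Hamiltonian of $U$ has the form $iS$ with $S$ real skew-symmetric, so that the $H$-digraph $Z_n$ exists (and is unique). Every face $f_{ab}$ misses exactly one vertex $u$. The map $f:(a,b)\mapsto(u,a)$, where $u$ is the unique vertex missed by $f_{ab}$, is an isomorphism from $Z_n$ to the line digraph of $K_n$ as an oriented graph: it is a bijection on the arcs of $K_n$; there is an arc from $x$ to $y$ in $Z_n$ if and only if there is an arc from $f(x)$ to $f(y)$ in $LD^{\circ}(K_n)$; and for some constant $\kappa>0$ the skew-adjacency matrix of $Z_n$ satisfies $S_{x,y}=\kappa\,A_{f(x),f(y)}$, where $A$ is the skew-adjacency matrix of $LD(K_n)$, so that all arcs of $Z_n$ have the same weight $\kappa$. With the opposite sign convention for skew-adjacency matrices, which reverses all arcs of $Z_n$, the map $(a,b)\mapsto(a,u)$ is an isomorphism onto $LD^{\circ}(K_n)$. -/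

import Mathlib

open Matrix

noncomputable section

/-- A cellular embedding of a (connected) graph `G` in an oriented closed surface, encoded by its
rotation system: `rot` sends an arc `(a,b)` to the next arc with tail `a` in the cyclic order around
`a`, so that its cycles are exactly the sets of arcs with a common tail. -/
structure OrientedEmbedding {V : Type*} (G : SimpleGraph V) where
  rot : Equiv.Perm G.Dart
  rot_fst : ∀ d, (rot d).fst = d.fst
  rot_sameCycle : ∀ d e : G.Dart, d.fst = e.fst → rot.SameCycle d e

namespace OrientedEmbedding

variable {V : Type*} {G : SimpleGraph V} (E : OrientedEmbedding G)

/-- The successor in the facial walks: having traversed `(a,b)`, continue along the arc that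
follows `(b,a)` in the rotation at `b`. -/
def facePerm : Equiv.Perm G.Dart :=
  (SimpleGraph.Dart.symm_involutive (G := G)).toPerm.trans E.rot

/-- The faces are the cycles of `facePerm`. -/
def Face : Type _ := Quotient (Equiv.Perm.SameCycle.setoid E.facePerm)

/-- The unique face whose facial walk contains the arc `d`. -/
def face (d : G.Dart) : E.Face := Quotient.mk (Equiv.Perm.SameCycle.setoid E.facePerm) d

instance [Finite G.Dart] : Finite E.Face :=
  Quotient.finite (Equiv.Perm.SameCycle.setoid E.facePerm)

instance [Finite G.Dart] : Fintype E.Face := Fintype.ofFinite _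

/-- The vertex `v` is not on the face `F`. -/
def Misses (F : E.Face) (v : V) : Prop := ∀ d : G.Dart, E.face d = F → d.fst ≠ v

/-- Every face is bounded by a cycle of `G`: a facial walk repeats no vertex and does not
merely run along an edge and back. -/
def IsCircular : Prop :=
  (∀ d e : G.Dart, E.face d = E.face e → d.fst = e.fst → d = e) ∧
    ∀ d : G.Dart, E.facePerm (E.facePerm d) ≠ d

/-- The dual graph is isomorphic to `G`. The dual is the multigraph on the faces in which each
edge of `G`, with arcs `d` and `d.symm`, joins the face of `d` to the face of `d.symm`; an
isomorphism is a bijection on vertices together with a compatible bijection on arcs. -/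
def IsSelfDual : Prop :=
  ∃ (φ : V ≃ E.Face) (ψ : G.Dart ≃ G.Dart), ∀ d : G.Dart,
    ψ d.symm = (ψ d).symm ∧ E.face (ψ d) = φ d.fst ∧ E.face (ψ d).symm = φ d.snd

end OrientedEmbedding

/-- Scale each column of a real matrix to a unit vector (zero columns stay zero). -/
def normalizeCols {m n : Type*} [Fintype m] (M : Matrix m n ℝ) : Matrix m n ℝ :=
  Matrix.of fun i j => M i j / √(∑ k, M k j ^ 2)

namespace OrientedEmbedding

variable {V : Type*} [Fintype V] [DecidableEq V] {G : SimpleGraph V} [DecidableRel G.Adj]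
  (E : OrientedEmbedding G)

open Classical in
/-- The arc-face incidence matrix. -/
def arcFace : Matrix G.Dart E.Face ℝ := Matrix.of fun d F => if E.face d = F then 1 else 0

/-- The arc-tail incidence matrix. -/
def arcTail (_E : OrientedEmbedding G) : Matrix G.Dart V ℝ :=
  Matrix.of fun d v => if d.fst = v then 1 else 0

/-- The transition matrix `(2 M̂ M̂ᵀ - I) (2 N̂ N̂ᵀ - I)` of the vertex-face walk. -/
def vertexFaceWalk : Matrix G.Dart G.Dart ℝ :=
  ((2 : ℝ) • (normalizeCols E.arcFace * (normalizeCols E.arcFace)ᵀ) - 1) *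
    ((2 : ℝ) • (normalizeCols E.arcTail * (normalizeCols E.arcTail)ᵀ) - 1)

end OrientedEmbedding

/-- `H` is the principal Hamiltonian of `U`: it is Hermitian, `U = exp (iH)`, and its
eigenvalues lie in `(-π, π]`. -/
def IsPrincipalHamiltonian {n : Type*} [Fintype n] [DecidableEq n] (U H : Matrix n n ℂ) : Prop :=
  H.IsHermitian ∧ NormedSpace.exp (Complex.I • H) = U ∧
    spectrum ℝ H ⊆ Set.Ioc (-Real.pi) Real.pi

/-- A weighted oriented graph: `weight x y` is the positive weight of the arc from `x` to `y`,
and is `0` if there is no such arc; there are no loops and no pairs of opposite arcs. -/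
structure WeightedOrientedGraph (α : Type*) where
  weight : α → α → ℝ
  nonneg : ∀ x y, 0 ≤ weight x y
  oriented : ∀ x y, weight x y = 0 ∨ weight y x = 0

/-- The digraph of the arcs of a weighted oriented graph. -/
def WeightedOrientedGraph.arcs {α : Type*} (Z : WeightedOrientedGraph α) : Digraph α where
  Adj x y := 0 < Z.weight x y

/-- The skew-adjacency matrix, in the convention (matrices act on column vectors) in which an arc
from `x` to `y` of weight `w` gives `w` in position `(y,x)` and `-w` in position `(x,y)`. -/
def WeightedOrientedGraph.skewAdj {α : Type*} (Z : WeightedOrientedGraph α) : Matrix α α ℝ :=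
  Matrix.of fun x y => Z.weight y x - Z.weight x y

/-- `Z` is the `H`-digraph of the real matrix `U`: the principal Hamiltonian of `U` is `iS`
where `S` is the skew-adjacency matrix of `Z`. -/
def IsHDigraph {n : Type*} [Fintype n] [DecidableEq n] (U : Matrix n n ℝ)
    (Z : WeightedOrientedGraph n) : Prop :=
  IsPrincipalHamiltonian (U.map ((↑) : ℝ → ℂ)) (Complex.I • Z.skewAdj.map ((↑) : ℝ → ℂ))

/-- The line digraph: its vertices are the arcs of `G`, with an arc from `(a,b)` to `(c,d)`
if and only if `b = c`. -/
def lineDigraph {V : Type*} (G : SimpleGraph V) : Digraph G.Dart where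
  Adj x y := x.snd = y.fst

/-- The oriented graph of a digraph: pairs of opposite arcs (and loops) cancel. -/
def orientedPart {α : Type*} (D : Digraph α) : Digraph α where
  Adj x y := D.Adj x y ∧ ¬ D.Adj y x

open Classical in
/-- The skew-adjacency matrix of a digraph, in the same convention as for weighted oriented
graphs: each arc from `x` to `y` contributes `1` in position `(y,x)` and `-1` in `(x,y)`. -/
def digraphSkewAdj {α : Type*} (D : Digraph α) : Matrix α α ℝ :=
  Matrix.of fun x y => (if D.Adj y x then 1 else 0) - (if D.Adj x y then 1 else 0)

end

/-! Let `m = n - 1`. Self-duality gives `n` faces of length `m`; with circularity, each face misses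
one vertex and each vertex is missed by one face (`exists_missedVertexEquiv`). So (face, tail) maps
the arcs bijectively onto the complement of the graph of a bijection `μ`. For the face and tail
projections `p`, `q`, the entries of `pq` are then `1 / m ^ 2` off the pairs matched by `μ` and `0`
on them, and `pqp`, `qpq` equal a common multiple of the all-ones matrix plus `b p`, `b q`, where `b
= 1 / m ^ 2` (`fiberMatrix_mul_mul`).

Hence `K = pq - qp` satisfies `K ^ 3 = b (b - 1) K`, and `U = 1 + 2 K + (2 / b) K ^ 2`. This is `exp
(iH)` for a suitable imaginary multiple `H` of `K` with eigenvalues among `0, ±φ`, `cos φ = 2 b -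
1`. In `qp - pq` the constant `1 / m ^ 2` cancels, leaving the line digraph. -/

/-! ### Principal Hamiltonians and functional calculus. -/

/-- A Hermitian matrix is the image of its eigenvalues under an algebra embedding of the diagonal
matrices which commutes with the exponential. -/
theorem Matrix.IsHermitian.exists_diagonalization {n : Type*} [Fintype n] [DecidableEq n]
    {H : Matrix n n ℂ} (hH : H.IsHermitian) :
    ∃ ρ : (n → ℂ) →ₐ[ℂ] Matrix n n ℂ, Function.Injective ρ ∧
      ρ (fun i => (hH.eigenvalues i : ℂ)) = H ∧
      ∀ v, NormedSpace.exp (ρ v) = ρ fun i => Complex.exp (v i) := by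
  let c := Unitary.conjStarAlgAut ℂ (Matrix n n ℂ) hH.eigenvectorUnitary
  refine ⟨(c.toAlgEquiv : Matrix n n ℂ →ₐ[ℂ] Matrix n n ℂ).comp (diagonalAlgHom ℂ),
    c.injective.comp diagonal_injective, hH.spectral_theorem.symm, fun v => ?_⟩
  change NormedSpace.exp (c (diagonal v)) = c (diagonal _)
  have h := Matrix.exp_units_conj (Unitary.toUnits hH.eigenvectorUnitary) (diagonal v)
  rw [Matrix.exp_diagonal] at h
  refine h.trans ?_
  change c (diagonal _) = _
  congr 2
  ext i
  rw [Complex.exp_eq_exp_ℂ, Pi.coe_exp]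

theorem Matrix.IsHermitian.exp_I_smul_eq_aeval {n : Type*} [Fintype n] [DecidableEq n]
    {H : Matrix n n ℂ} (hH : H.IsHermitian) (q : Polynomial ℂ)
    (hq : ∀ i, q.eval (hH.eigenvalues i : ℂ) = Complex.exp (Complex.I * hH.eigenvalues i)) :
    NormedSpace.exp (Complex.I • H) = Polynomial.aeval H q := by
  obtain ⟨ρ, -, hρ, hexp⟩ := hH.exists_diagonalization
  conv_lhs => rw [← hρ, ← map_smul, hexp]
  conv_rhs => rw [← hρ, Polynomial.aeval_algHom_apply]
  congr 1
  ext i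
  rw [Polynomial.aeval_pi_apply₂, Polynomial.coe_aeval_eq_eval, hq]
  simp

theorem Matrix.IsHermitian.aeval_exp_I_smul {n : Type*} [Fintype n] [DecidableEq n]
    {H : Matrix n n ℂ} (hH : H.IsHermitian) (q : Polynomial ℂ)
    (hq : ∀ i, q.eval (Complex.exp (Complex.I * hH.eigenvalues i)) = hH.eigenvalues i) :
    Polynomial.aeval (NormedSpace.exp (Complex.I • H)) q = H := by
  obtain ⟨ρ, -, hρ, hexp⟩ := hH.exists_diagonalization
  conv_lhs => rw [← hρ, ← map_smul, hexp, Polynomial.aeval_algHom_apply]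
  conv_rhs => rw [← hρ]
  congr 1
  ext i
  rw [Polynomial.aeval_pi_apply₂, ← hq i]
  simp [← Polynomial.coe_aeval_eq_eval]

theorem injOn_exp_I_mul :
    Set.InjOn (fun x : ℝ => Complex.exp (Complex.I * x)) (Set.Ioc (-Real.pi) Real.pi) := by
  intro x hx y hy h
  have h' := Complex.exp_inj_of_neg_pi_lt_of_le_pi (x := Complex.I * x) (y := Complex.I * y)
    (by simpa using hx.1) (by simpa using hx.2) (by simpa using hy.1) (by simpa using hy.2) h
  simpa using h'

/-- The principal Hamiltonian is unique: it is a polynomial in `U`. -/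
theorem IsPrincipalHamiltonian.unique {n : Type*} [Fintype n] [DecidableEq n]
    {U H₁ H₂ : Matrix n n ℂ} (h₁ : IsPrincipalHamiltonian U H₁)
    (h₂ : IsPrincipalHamiltonian U H₂) : H₁ = H₂ := by
  classical
  obtain ⟨hH₁, he₁, hs₁⟩ := h₁
  obtain ⟨hH₂, he₂, hs₂⟩ := h₂
  -- Interpolating over both spectra at once gives a single polynomial that recovers both `H₁` and
  -- `H₂` from `U`.
  let s : Finset ℝ := Finset.univ.image hH₁.eigenvalues ∪ Finset.univ.image hH₂.eigenvalues
  let e : ℝ → ℂ := fun x => Complex.exp (Complex.I * x)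
  have hs : Set.InjOn e s := by
    refine injOn_exp_I_mul.mono fun x hx => ?_
    simp only [s, Finset.coe_union, Finset.coe_image, Finset.coe_univ, Set.image_univ] at hx
    rcases hx with ⟨i, rfl⟩ | ⟨i, rfl⟩
    · exact hs₁ (hH₁.eigenvalues_mem_spectrum_real i)
    · exact hs₂ (hH₂.eigenvalues_mem_spectrum_real i)
  let q : Polynomial ℂ := Lagrange.interpolate s e fun x => (x : ℂ)
  have hq : ∀ x ∈ s, q.eval (e x) = x := fun x hx =>
    Lagrange.eval_interpolate_at_node _ hs hx
  rw [← hH₁.aeval_exp_I_smul q fun i => hq _ (by simp [s]),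
    ← hH₂.aeval_exp_I_smul q fun i => hq _ (by simp [s]), he₁, he₂]

/-- A Hermitian matrix with eigenvalues among `0, φ, -φ`, where `0 < φ < π`, is the principal
Hamiltonian of a quadratic polynomial in itself. -/
theorem isPrincipalHamiltonian_of_pow_three {n : Type*} [Fintype n] [DecidableEq n]
    {H : Matrix n n ℂ} (hH : H.IsHermitian) {φ : ℝ} (hφ : 0 < φ) (hφ' : φ < Real.pi)
    (h3 : H ^ 3 = ((φ : ℂ) ^ 2) • H) :
    IsPrincipalHamiltonian
      (1 + (Complex.I * (Real.sin φ / φ : ℝ)) • H + ((((Real.cos φ - 1) / φ ^ 2 : ℝ)) : ℂ) • H ^ 2)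
      H := by
  have hev : ∀ i, hH.eigenvalues i = 0 ∨ hH.eigenvalues i = φ ∨ hH.eigenvalues i = -φ := by
    intro i
    obtain ⟨ρ, hinj, hρ, -⟩ := hH.exists_diagonalization
    have h : ρ ((fun i => (hH.eigenvalues i : ℂ)) ^ 3) =
        ρ (((φ : ℂ) ^ 2) • fun i => (hH.eigenvalues i : ℂ)) := by
      rw [map_pow, map_smul, hρ, h3]
    have h' := congrFun (hinj h) i
    simp only [Pi.pow_apply, Pi.smul_apply, smul_eq_mul] at h'
    have h'' : hH.eigenvalues i ^ 3 = φ ^ 2 * hH.eigenvalues i := by exact_mod_cast h'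
    have : hH.eigenvalues i * ((hH.eigenvalues i - φ) * (hH.eigenvalues i + φ)) = 0 := by
      linear_combination h''
    rcases mul_eq_zero.1 this with h | h
    · exact Or.inl h
    rcases mul_eq_zero.1 h with h | h
    · exact Or.inr (Or.inl (by linarith))
    · exact Or.inr (Or.inr (by linarith))
  refine ⟨hH, ?_, ?_⟩
  -- The quadratic interpolating `exp (i x)` at `0, φ, -φ`: odd part from `sin`, even part from
  -- `cos`.
  · let q : Polynomial ℂ := 1 + Polynomial.C (Complex.I * (Real.sin φ / φ : ℝ)) * Polynomial.X +
      Polynomial.C ((((Real.cos φ - 1) / φ ^ 2 : ℝ)) : ℂ) * Polynomial.X ^ 2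
    have hφ0 : (φ : ℂ) ≠ 0 := by exact_mod_cast hφ.ne'
    rw [hH.exp_I_smul_eq_aeval q]
    · simp [q, Algebra.smul_def]
    · intro i
      rcases hev i with h | h | h
      · simp [q, h]
      · rw [h, mul_comm Complex.I, Complex.exp_mul_I]
        simp only [q, Polynomial.eval_add, Polynomial.eval_mul, Polynomial.eval_C,
          Polynomial.eval_X, Polynomial.eval_one, Polynomial.eval_pow]
        push_cast
        field_simp
        ring
      · rw [h, mul_comm Complex.I, Complex.exp_mul_I]
        simp only [q, Polynomial.eval_add, Polynomial.eval_mul, Polynomial.eval_C,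
          Polynomial.eval_X, Polynomial.eval_one, Polynomial.eval_pow]
        push_cast
        rw [Complex.cos_neg, Complex.sin_neg]
        field_simp
        ring
  · rw [hH.spectrum_real_eq_range_eigenvalues]
    rintro _ ⟨i, rfl⟩
    rcases hev i with h | h | h <;> rw [h] <;> constructor <;> linarith [Real.pi_pos]

/-! ### Projections onto functions constant on fibres. -/

/-- The matrix with entry `1 / m` at pairs of indices in the same fibre of `f`. -/
noncomputable def fiberMatrix {D A : Type*} [DecidableEq A] (f : D → A) (m : ℕ) : Matrix D D ℝ :=
  Matrix.of fun x y => if f x = f y then 1 / (m : ℝ) else 0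

section FiberMatrix

variable {D A B : Type*} [DecidableEq A] [DecidableEq B] {f : D → A} {g : D → B} {m : ℕ}

theorem fiberMatrix_transpose : (fiberMatrix f m)ᵀ = fiberMatrix f m := by
  ext x y
  simp [fiberMatrix, eq_comm]

variable [Fintype D]

theorem fiberMatrix_mul_self (hm : m ≠ 0) (hf : ∀ a, (Finset.univ.filter (f · = a)).card = m) :
    fiberMatrix f m * fiberMatrix f m = fiberMatrix f m := by
  ext x y
  simp only [fiberMatrix, Matrix.mul_apply, Matrix.of_apply]
  have h : ∀ z, ((if f x = f z then 1 / (m : ℝ) else 0) * if f z = f y then 1 / (m : ℝ) else 0) =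
      (if f x = f y then 1 / (m : ℝ) ^ 2 else 0) * if f z = f x then 1 else 0 := by
    intro z
    by_cases h1 : f z = f x
    · simp [h1]; split_ifs <;> field_simp
    · simp [h1, Ne.symm h1]
  simp only [h, ← Finset.mul_sum, Finset.sum_boole, hf]
  have : (m : ℝ) ≠ 0 := by exact_mod_cast hm
  split_ifs <;> field_simp
  simp

theorem fiberMatrix_mul_ones (hm : m ≠ 0) (hf : ∀ a, (Finset.univ.filter (f · = a)).card = m) :
    fiberMatrix f m * Matrix.of (fun _ _ : D => (1 : ℝ)) = Matrix.of fun _ _ => 1 := by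
  have hm' : (m : ℝ) ≠ 0 := by exact_mod_cast hm
  ext x y
  simp only [fiberMatrix, Matrix.mul_apply, Matrix.of_apply, mul_one, eq_comm (a := f x)]
  rw [← Finset.sum_filter, Finset.sum_const, hf]
  simp [hm']

variable (μ : A ≃ B)

/-- If `(f, g)` maps bijectively onto the complement of the graph of `μ`, then the product of the
two fibre matrices records that complement. -/
theorem fiberMatrix_mul_fiberMatrix_apply (hne : ∀ d, μ (f d) ≠ g d)
    (hex : ∀ a b, μ a ≠ b → ∃! d, f d = a ∧ g d = b) (x y : D) :
    (fiberMatrix f m * fiberMatrix g m) x y = if μ (f x) = g y then 0 else 1 / (m : ℝ) ^ 2 := by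
  simp only [fiberMatrix, Matrix.mul_apply, Matrix.of_apply]
  split_ifs with h
  · refine Finset.sum_eq_zero fun z _ => ?_
    by_cases h1 : f x = f z
    · have : g z ≠ g y := fun h2 => hne z (by rw [← h1, h, h2])
      simp [this]
    · simp [h1]
  · obtain ⟨d, ⟨h1, h2⟩, hd⟩ := hex _ _ h
    rw [Finset.sum_eq_single d]
    · simp [h1, h2, pow_two]
    · intro z _ hz
      by_cases h3 : f x = f z
      · have : g z ≠ g y := fun h4 => hz (hd z ⟨h3.symm, h4⟩)
        simp [this]
      · simp [h3]
    · simp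

theorem fiberMatrix_mul_mul (hm : m ≠ 0) (hf : ∀ a, (Finset.univ.filter (f · = a)).card = m)
    (hne : ∀ d, μ (f d) ≠ g d) (hex : ∀ a b, μ a ≠ b → ∃! d, f d = a ∧ g d = b) :
    fiberMatrix f m * fiberMatrix g m * fiberMatrix f m =
      (((m : ℝ) - 1) / (m : ℝ) ^ 3) • Matrix.of (fun _ _ => (1 : ℝ)) +
        (1 / (m : ℝ) ^ 2) • fiberMatrix f m := by
  have hm' : (m : ℝ) ≠ 0 := by exact_mod_cast hm
  ext x y
  rw [Matrix.mul_apply]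
  simp_rw [fiberMatrix_mul_fiberMatrix_apply μ hne hex]
  simp only [Matrix.add_apply, Matrix.smul_apply, Matrix.of_apply, fiberMatrix, smul_eq_mul]
  -- The sum counts the `m` points of the fibre of `y`, less the one matched with `f x`. That point
  -- is absent exactly when `f x = f y`, which produces the extra multiple of `fiberMatrix f m`.
  have h : ∀ z, ((if μ (f x) = g z then 0 else 1 / (m : ℝ) ^ 2) *
      if f z = f y then 1 / (m : ℝ) else 0) =
      1 / (m : ℝ) ^ 3 * ((if f z = f y then 1 else 0) -
        if f z = f y ∧ g z = μ (f x) then 1 else 0) := by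
    intro z
    by_cases h1 : f z = f y <;> by_cases h2 : g z = μ (f x)
    · simp [h1, h2]
    · simp [h1, h2, Ne.symm h2]; field_simp
    · simp [h1]
    · simp [h1]
  simp only [h, ← Finset.mul_sum, Finset.sum_sub_distrib, Finset.sum_boole, hf]
  by_cases hxy : f x = f y
  · have : (Finset.univ.filter fun z => f z = f y ∧ g z = μ (f x)) = ∅ := by
      refine Finset.filter_eq_empty_iff.2 fun z _ hz => hne z ?_
      rw [hz.1, hz.2, hxy]
    rw [this]
    simp [hxy]
    field_simp
    ring
  · obtain ⟨d, hd, hd'⟩ := hex (f y) (μ (f x)) fun h => hxy (μ.injective h).symm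
    have : (Finset.univ.filter fun z => f z = f y ∧ g z = μ (f x)) = {d} := by
      ext z
      simp only [Finset.mem_filter, Finset.mem_univ, true_and, Finset.mem_singleton]
      exact ⟨hd' z, fun h => h ▸ hd⟩
    rw [this]
    simp [hxy]
    field_simp

end FiberMatrix

/-! ### Products of two reflections. -/

/-- Two idempotents for which `pqp` and `qpq` differ from multiples of `p` and `q` by a common
element absorbed by both. -/
theorem commutator_identities {R : Type*} [Ring R] [Algebra ℝ R] {p q j : R} {b : ℝ}
    (hp : p * p = p) (hq : q * q = q) (hpj : p * j = j) (hqj : q * j = j)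
    (hpqp : p * q * p = j + b • p) (hqpq : q * p * q = j + b • q) :
    (p * q - q * p) ^ 2 = b • (p * q + q * p - p - q) ∧
      (p * q - q * p) ^ 3 = (b * (b - 1)) • (p * q - q * p) := by
  have hpp : ∀ x, p * (p * x) = p * x := fun x => by rw [← mul_assoc, hp]
  have hqq : ∀ x, q * (q * x) = q * x := fun x => by rw [← mul_assoc, hq]
  have h1 : p * (q * p) = j + b • p := by rw [← mul_assoc, hpqp]
  have h2 : q * (p * q) = j + b • q := by rw [← mul_assoc, hqpq]
  have hsq : (p * q - q * p) ^ 2 = b • (p * q + q * p - p - q) := by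
    simp only [pow_two, mul_sub, sub_mul, mul_assoc, hpp, hqq, h1, h2, mul_add,
      mul_smul_comm, hpj, hqj]
    module
  refine ⟨hsq, ?_⟩
  rw [pow_succ', hsq, mul_smul_comm, mul_smul]
  congr 1
  simp only [mul_sub, sub_mul, mul_assoc, hp, hq, hpp, hqq, h1, h2, mul_add,
      mul_smul_comm, hpj, hqj]
  module

/-- The product of the reflections in two symmetric idempotents whose principal angles `θ` are
either zero or have `cos θ ^ 2 = b` has a multiple of the commutator as principal Hamiltonian. -/
theorem isPrincipalHamiltonian_reflections {n : Type*} [Fintype n] [DecidableEq n]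
    {p q j : Matrix n n ℝ} {b φ : ℝ} (hφ : 0 < φ) (hφ' : φ < Real.pi)
    (hb : Real.cos φ = 2 * b - 1)
    (hpt : pᵀ = p) (hqt : qᵀ = q) (hp : p * p = p) (hq : q * q = q) (hpj : p * j = j)
    (hqj : q * j = j) (hpqp : p * q * p = j + b • p) (hqpq : q * p * q = j + b • q) :
    IsPrincipalHamiltonian
      ((((2 : ℝ) • p - 1) * ((2 : ℝ) • q - 1)).map ((↑) : ℝ → ℂ))
      (Complex.I • ((2 * φ / Real.sin φ) • (q * p - p * q)).map ((↑) : ℝ → ℂ)) := by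
  obtain ⟨hK2, hK3⟩ := commutator_identities hp hq hpj hqj hpqp hqpq
  have hsin : 0 < Real.sin φ := Real.sin_pos_of_pos_of_lt_pi hφ hφ'
  have hsq : Real.sin φ ^ 2 = 4 * (b * (1 - b)) := by
    rw [Real.sin_sq, hb]; ring
  let T : Matrix n n ℝ →ₐ[ℝ] Matrix n n ℂ := Complex.ofRealAm.mapMatrix
  -- Forced by matching the linear term: `(sin φ / φ) * c = 2`, the coefficient of `K` in `U`.
  set c : ℝ := 2 * φ / Real.sin φ with hc
  have hcs : c * Real.sin φ = 2 * φ := by rw [hc]; field_simp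
  have hcb : c ^ 2 * (b * (1 - b)) = φ ^ 2 := by
    have : (c * Real.sin φ) ^ 2 = 4 * φ ^ 2 := by rw [hcs]; ring
    rw [mul_pow, hsq] at this
    linarith
  have hT : ∀ M : Matrix n n ℝ, M.map ((↑) : ℝ → ℂ) = T M := fun _ => rfl
  have hsm : ∀ (r : ℝ) (M : Matrix n n ℝ), T (r • M) = (r : ℂ) • T M := fun r M => by
    rw [map_smul, Complex.coe_smul]
  set K := p * q - q * p with hK
  have hH : Complex.I • T (c • (q * p - p * q)) = (-(Complex.I * c)) • T K := by
    rw [hsm, smul_smul, ← neg_sub (p * q), ← hK, map_neg, smul_neg, neg_smul]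
  have hKt : (T K)ᴴ = -T K := by
    have h : (T K)ᴴ = T Kᵀ := by
      ext x y
      change star ((K y x : ℝ) : ℂ) = ((K y x : ℝ) : ℂ)
      simp
    rw [h, ← map_neg, hK, transpose_sub, transpose_mul, transpose_mul, hpt, hqt, neg_sub]
  rw [hT, hT, hH]
  have key := isPrincipalHamiltonian_of_pow_three (H := (-(Complex.I * c)) • T K) ?_ hφ hφ' ?_
  · convert key using 1
    have h1 : Complex.I * ((Real.sin φ / φ : ℝ) : ℂ) * (-(Complex.I * c)) = ((2 : ℝ) : ℂ) := by
      have : Real.sin φ / φ * c = 2 := by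
        field_simp
        linarith
      rw [← this]
      push_cast
      linear_combination (-((Complex.sin φ / φ) * (c : ℂ))) * Complex.I_sq
    have h2 : (((Real.cos φ - 1) / φ ^ 2 : ℝ) : ℂ) * (-(Complex.I * c)) ^ 2 * (b : ℂ) =
        ((2 : ℝ) : ℂ) := by
      have : (Real.cos φ - 1) / φ ^ 2 * (-(c ^ 2) * b) = 2 := by
        rw [hb]
        field_simp
        linear_combination 2 * hcb
      rw [← this]
      push_cast
      linear_combination ((Complex.cos φ - 1) / φ ^ 2 * (c : ℂ) ^ 2 * b) * Complex.I_sq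
    rw [smul_smul, h1, smul_pow, ← map_pow, hK2, hsm b, smul_smul, smul_smul, h2, ← hsm, ← hsm,
      ← map_one T, ← map_add, ← map_add]
    congr 1
    simp only [hK, mul_sub, sub_mul, smul_mul_assoc, mul_smul_comm, mul_one, one_mul]
    module
  · change _ᴴ = _
    rw [conjTranspose_smul, hKt]
    simp
  · rw [smul_pow, ← map_pow, hK3, hsm, smul_smul, smul_smul]
    congr 1
    have hcb' : (c : ℂ) ^ 2 * (b * (1 - b)) = φ ^ 2 := by exact_mod_cast hcb
    push_cast
    linear_combination (-((c : ℂ) ^ 3 * b * (b - 1) * Complex.I)) * Complex.I_sq - Complex.I * c * hcb'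

/-- Every column has norm `√m`, so two normalized entries multiply to `1 / m`. -/
theorem normalizeCols_indicator_mul_transpose {D A : Type*} [Fintype D] [Fintype A]
    [DecidableEq A] {f : D → A} {m : ℕ} (hf : ∀ a, (Finset.univ.filter (f · = a)).card = m) :
    normalizeCols (Matrix.of fun d a => if f d = a then (1 : ℝ) else 0) *
      (normalizeCols (Matrix.of fun d a => if f d = a then (1 : ℝ) else 0))ᵀ =
      fiberMatrix f m := by
  have h : ∀ a, ∑ d, (if f d = a then (1 : ℝ) else 0) ^ 2 = m := fun a => by
    simp [← hf a]
  ext x y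
  simp only [Matrix.mul_apply, normalizeCols, Matrix.of_apply, Matrix.transpose_apply, h,
    fiberMatrix]
  rw [Finset.sum_eq_single (f x)]
  · by_cases hxy : f x = f y
    · simp [hxy, ← mul_inv]
    · simp [hxy, Ne.symm hxy]
  · intro a _ ha
    simp [Ne.symm ha]
  · simp

/-! ### Weighted oriented graphs and skew-symmetric matrices. -/

namespace WeightedOrientedGraph

variable {α : Type*}

/-- At most one of two opposite weights is nonzero, so the positive part of the skew-adjacency
matrix loses nothing. -/
theorem weight_eq_max (Z : WeightedOrientedGraph α) (x y : α) :
    Z.weight x y = max (Z.skewAdj y x) 0 := by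
  have h1 := Z.nonneg x y
  have h2 := Z.nonneg y x
  change _ = max (Z.weight x y - Z.weight y x) 0
  rcases Z.oriented x y with h | h <;> rw [h]
  · simp [h2]
  · simp [h1]

theorem skewAdj_injective : Function.Injective (skewAdj (α := α)) := by
  intro Z Z' h
  have hw : Z.weight = Z'.weight := by
    ext x y
    rw [weight_eq_max, weight_eq_max, h]
  cases Z
  cases Z'
  cases hw
  rfl

theorem exists_skewAdj_eq {S : Matrix α α ℝ} (hS : ∀ x y, S x y = -S y x) :
    ∃ Z : WeightedOrientedGraph α, Z.skewAdj = S := by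
  refine ⟨⟨fun x y => max (S y x) 0, fun x y => le_max_right _ _, fun x y => ?_⟩, ?_⟩
  · rw [hS y x]
    rcases le_total (S x y) 0 with h | h
    · exact Or.inr (max_eq_right h)
    · exact Or.inl (max_eq_right (by linarith))
  · ext x y
    change max (S x y) 0 - max (S y x) 0 = S x y
    rw [hS y x]
    rcases le_total (S x y) 0 with h | h
    · rw [max_eq_right h, max_eq_left (by linarith)]; ring
    · rw [max_eq_left h, max_eq_right (by linarith)]; ring

theorem arcs_adj_iff (Z : WeightedOrientedGraph α) (x y : α) :
    Z.arcs.Adj x y ↔ 0 < Z.skewAdj y x := by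
  change 0 < Z.weight x y ↔ _
  rw [weight_eq_max]
  simp

end WeightedOrientedGraph

theorem digraphSkewAdj_pos_iff {α : Type*} (D : Digraph α) (x y : α) :
    0 < digraphSkewAdj D y x ↔ (orientedPart D).Adj x y := by
  simp only [digraphSkewAdj, Matrix.of_apply, orientedPart]
  by_cases h : D.Adj x y <;> by_cases h' : D.Adj y x <;> simp [h, h']

theorem digraphSkewAdj_antisymm {α : Type*} (D : Digraph α) (x y : α) :
    digraphSkewAdj D x y = -digraphSkewAdj D y x := by
  simp [digraphSkewAdj]

theorem Finset.existsUnique_forall_ne_of_injOn {D A : Type*} [Fintype A] {s : Finset D}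
    {f : D → A} (hf : Set.InjOn f s) (hs : s.card + 1 = Fintype.card A) :
    ∃! a, ∀ d ∈ s, f d ≠ a := by
  classical
  have h : ((s.image f)ᶜ).card = 1 := by
    rw [Finset.card_compl, Finset.card_image_of_injOn hf, ← hs]
    simp
  obtain ⟨a, ha⟩ := Finset.card_eq_one.1 h
  have h' : ∀ b, (∀ d ∈ s, f d ≠ b) ↔ b = a := fun b => by
    rw [← Finset.mem_singleton, ← ha]
    simp
  exact ⟨a, (h' a).2 rfl, fun b hb => (h' b).1 hb⟩

/-! ### Faces of circular self-dual embeddings. -/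

namespace OrientedEmbedding

variable {V : Type*} [Fintype V] {E : OrientedEmbedding (⊤ : SimpleGraph V)}

/-- If two facial steps from `d` led back to its tail, circularity would make the walk close after
two steps. This rules out `n = 2`, where `b = 1` and `sin φ = 0`. -/
theorem IsCircular.two_lt_card (hcirc : E.IsCircular) (d : (⊤ : SimpleGraph V).Dart) :
    2 < Fintype.card V := by
  have hs : ∀ e : (⊤ : SimpleGraph V).Dart, (E.facePerm e).fst = e.snd := fun e =>
    E.rot_fst e.symm
  have hf : ∀ e, E.face (E.facePerm e) = E.face e := fun e =>
    Quotient.sound (Equiv.Perm.SameCycle.symm ⟨1, by simp⟩)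
  refine Fintype.two_lt_card_iff.2 ⟨d.fst, d.snd, (E.facePerm d).snd, d.adj.ne, fun h => ?_, ?_⟩
  · refine hcirc.2 d (hcirc.1 _ _ ((hf _).trans (hf _)) ?_)
    rw [hs, h]
  · rw [← hs d]
    exact (E.facePerm d).adj.ne

variable [DecidableEq V]

theorem card_darts_fst_eq (v : V) :
    (Finset.univ.filter fun d : (⊤ : SimpleGraph V).Dart => d.fst = v).card =
      Fintype.card V - 1 := by
  rw [SimpleGraph.dart_fst_fiber_card_eq_degree, SimpleGraph.complete_graph_degree]

open Classical in
-- The arc bijection `ψ` carries the arcs leaving a vertex to the arcs on the corresponding face.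
theorem IsSelfDual.card_darts_face_eq (hdual : E.IsSelfDual) (F : E.Face) :
    (Finset.univ.filter fun d => E.face d = F).card = Fintype.card V - 1 := by
  obtain ⟨φ, ψ, h⟩ := hdual
  rw [← card_darts_fst_eq (φ.symm F)]
  refine (Finset.card_equiv ψ fun d => ?_).symm
  simp [(h d).2.1, Equiv.eq_symm_apply]

/-- Each face misses exactly one vertex, and each vertex is missed by exactly one face. -/
theorem exists_missedVertexEquiv (hcirc : E.IsCircular) (hdual : E.IsSelfDual) :
    ∃ μ : E.Face ≃ V, ∀ F v, E.Misses F v ↔ μ F = v := by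
  classical
  have hcard : Fintype.card E.Face = Fintype.card V := by
    obtain ⟨φ, -⟩ := hdual
    exact (Fintype.card_congr φ).symm
  have h1 : ∀ F, ∃! v, E.Misses F v := fun F => by
    have : 0 < Fintype.card V := hcard ▸ Fintype.card_pos_iff.2 ⟨F⟩
    have := Finset.existsUnique_forall_ne_of_injOn (A := V)
      (s := Finset.univ.filter fun d => E.face d = F) (f := fun d => d.fst)
      (fun d hd e he h => hcirc.1 d e (by simp_all) h)
      (by rw [hdual.card_darts_face_eq]; omega)
    simpa [Misses] using this
  -- The same count with roles exchanged: the `n - 1` arcs leaving `v` lie on distinct faces.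
  have h2 : ∀ v, ∃! F, E.Misses F v := fun v => by
    have : 0 < Fintype.card V := Fintype.card_pos_iff.2 ⟨v⟩
    have := Finset.existsUnique_forall_ne_of_injOn (A := E.Face)
      (s := Finset.univ.filter fun d : (⊤ : SimpleGraph V).Dart => d.fst = v) (f := E.face)
      (fun d hd e he h => hcirc.1 d e h (by simp_all))
      (by rw [card_darts_fst_eq]; omega)
    convert this using 3 with F
    simp only [Finset.mem_filter, Finset.mem_univ, true_and]
    exact ⟨fun h d hd hF => h d hF hd, fun h d hF hd => h d hd hF⟩
  choose μ hμ hμ' using h1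
  choose ν hν hν' using h2
  refine ⟨⟨μ, ν, fun F => (hν' _ _ (hμ F)).symm, fun v => (hμ' _ _ (hν v)).symm⟩, fun F v => ?_⟩
  exact ⟨fun h => (hμ' F v h).symm, fun h => h ▸ hμ F⟩

/-- The skew-adjacency matrix of the line digraph, transported along `(a,b) ↦ (u,a)`, gives the
principal Hamiltonian. -/
theorem exists_isPrincipalHamiltonian (hcirc : E.IsCircular) (hdual : E.IsSelfDual)
    {μ : E.Face ≃ V} (hμ : ∀ F v, E.Misses F v ↔ μ F = v)
    {e : (⊤ : SimpleGraph V).Dart ≃ (⊤ : SimpleGraph V).Dart}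
    (he : ∀ d, (e d).fst = μ (E.face d) ∧ (e d).snd = d.fst) :
    ∃ κ : ℝ, 0 < κ ∧ IsPrincipalHamiltonian (E.vertexFaceWalk.map ((↑) : ℝ → ℂ))
      (Complex.I • (κ • (digraphSkewAdj (lineDigraph (⊤ : SimpleGraph V))).submatrix e e).map
        ((↑) : ℝ → ℂ)) := by
  classical
  rcases isEmpty_or_nonempty (⊤ : SimpleGraph V).Dart with hD | ⟨⟨d₀⟩⟩
  · exact ⟨1, one_pos, Subsingleton.elim _ _, Subsingleton.elim _ _, by simp⟩
  have hV := hcirc.two_lt_card d₀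
  set m := Fintype.card V - 1 with hm
  have hm2 : 2 ≤ m := by omega
  have hm0 : m ≠ 0 := by omega
  have hmR : (2 : ℝ) ≤ m := by exact_mod_cast hm2
  have hf := hdual.card_darts_face_eq
  have hg := card_darts_fst_eq (V := V)
  rw [← hm] at hf hg
  have hne : ∀ d : (⊤ : SimpleGraph V).Dart, μ (E.face d) ≠ d.fst := fun d h =>
    (hμ _ _).2 h d rfl rfl
  have hex : ∀ F v, μ F ≠ v → ∃! d, E.face d = F ∧ d.fst = v := fun F v h => by
    rw [Ne, ← hμ] at h
    simp only [Misses, not_forall, not_not] at h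
    obtain ⟨d, h1, h2⟩ := h
    exact ⟨d, ⟨h1, h2⟩, fun d' h' => hcirc.1 _ _ (h'.1.trans h1.symm) (h'.2.trans h2.symm)⟩
  have hne' : ∀ d : (⊤ : SimpleGraph V).Dart, μ.symm d.fst ≠ E.face d := fun d h =>
    hne d (by rw [← h, Equiv.apply_symm_apply])
  have hex' : ∀ v F, μ.symm v ≠ F → ∃! d : (⊤ : SimpleGraph V).Dart,
      d.fst = v ∧ E.face d = F := fun v F h => by
    simpa only [and_comm] using hex F v fun h' => h (by rw [← h', Equiv.symm_apply_apply])
  have hU : E.vertexFaceWalk = ((2 : ℝ) • fiberMatrix E.face m - 1) *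
      ((2 : ℝ) • fiberMatrix (fun d : (⊤ : SimpleGraph V).Dart => d.fst) m - 1) := by
    rw [← normalizeCols_indicator_mul_transpose hf, ← normalizeCols_indicator_mul_transpose hg]
    rfl
  set b : ℝ := 1 / (m : ℝ) ^ 2 with hb
  have hb0 : 0 < b := by positivity
  have hb1 : b < 1 := by rw [hb, div_lt_one (by positivity)]; nlinarith
  -- Twice the principal angle whose squared cosine is `b`; `0 < b < 1` keeps `φ` strictly between
  -- `0` and `π`.
  set φ := Real.arccos (2 * b - 1) with hφdef
  have hφ : 0 < φ := Real.arccos_pos.2 (by linarith)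
  have hφ' : φ < Real.pi := by
    refine lt_of_le_of_ne (Real.arccos_le_pi _) fun h => ?_
    have := Real.arccos_eq_pi.1 h
    linarith
  have hcos : Real.cos φ = 2 * b - 1 := Real.cos_arccos (by linarith) (by linarith)
  have hsin : 0 < Real.sin φ := Real.sin_pos_of_pos_of_lt_pi hφ hφ'
  refine ⟨2 * φ / Real.sin φ * b, by positivity, ?_⟩
  have key := isPrincipalHamiltonian_reflections hφ hφ' hcos fiberMatrix_transpose
    fiberMatrix_transpose (fiberMatrix_mul_self hm0 hf) (fiberMatrix_mul_self hm0 hg)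
    (j := (((m : ℝ) - 1) / (m : ℝ) ^ 3) • Matrix.of (fun _ _ => (1 : ℝ)))
    (by rw [mul_smul_comm, fiberMatrix_mul_ones hm0 hf])
    (by rw [mul_smul_comm, fiberMatrix_mul_ones hm0 hg])
    (fiberMatrix_mul_mul μ hm0 hf hne hex) (fiberMatrix_mul_mul μ.symm hm0 hg hne' hex')
  rw [hU]
  convert key using 3
  rw [mul_smul]
  congr 1
  ext x y
  rw [Matrix.sub_apply, fiberMatrix_mul_fiberMatrix_apply μ hne hex,
    fiberMatrix_mul_fiberMatrix_apply μ.symm hne' hex']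
  simp only [Matrix.smul_apply, Matrix.submatrix_apply, digraphSkewAdj, Matrix.of_apply,
    lineDigraph, (he _).1, (he _).2, smul_eq_mul, Equiv.symm_apply_eq, eq_comm (a := x.fst),
    eq_comm (a := y.fst)]
  -- Only the two matched incidences survive in the difference; if both hold they cancel, as
  -- opposite arcs do.
  split_ifs <;> simp [hb]

end OrientedEmbedding

/-! ### The isomorphism with the line digraph. -/

theorem mainTheorem5 {V : Type*} [Fintype V] [DecidableEq V]
    (E : OrientedEmbedding (⊤ : SimpleGraph V)) (hcirc : E.IsCircular) (hdual : E.IsSelfDual) :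
    (∃! Z : WeightedOrientedGraph (⊤ : SimpleGraph V).Dart, IsHDigraph E.vertexFaceWalk Z) ∧
    (∀ d, ∃! u, E.Misses (E.face d) u) ∧
    ∀ Z : WeightedOrientedGraph (⊤ : SimpleGraph V).Dart, IsHDigraph E.vertexFaceWalk Z →
      ∃ f : Z.arcs.Adj ≃r (orientedPart (lineDigraph (⊤ : SimpleGraph V))).Adj,
        (∀ d, E.Misses (E.face d) (f d).fst ∧ (f d).snd = d.fst) ∧
        (∃ κ : ℝ, 0 < κ ∧
          Z.skewAdj = κ • (digraphSkewAdj (lineDigraph (⊤ : SimpleGraph V))).submatrix f f) ∧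
        (∀ x y, Z.arcs.Adj y x ↔
          (orientedPart (lineDigraph (⊤ : SimpleGraph V))).Adj (f x).symm (f y).symm) := by
  
  obtain ⟨μ, hμ⟩ := OrientedEmbedding.exists_missedVertexEquiv hcirc hdual
  have hinj : Function.Injective fun d : (⊤ : SimpleGraph V).Dart =>
      (⟨(μ (E.face d), d.fst), fun h => (hμ _ _).2 h d rfl rfl⟩ : (⊤ : SimpleGraph V).Dart) := by
    intro d d' h
    have h' := congrArg SimpleGraph.Dart.toProd h
    exact hcirc.1 _ _ (μ.injective (congrArg Prod.fst h')) (congrArg Prod.snd h')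
  let e := Equiv.ofBijective _ (Finite.injective_iff_bijective.1 hinj)
  have he : ∀ d, (e d).fst = μ (E.face d) ∧ (e d).snd = d.fst := fun d => ⟨rfl, rfl⟩
  obtain ⟨κ, hκ, hS⟩ := OrientedEmbedding.exists_isPrincipalHamiltonian hcirc hdual hμ he
  have huniq : ∀ Z : WeightedOrientedGraph (⊤ : SimpleGraph V).Dart,
      IsHDigraph E.vertexFaceWalk Z → Z.skewAdj =
        κ • (digraphSkewAdj (lineDigraph (⊤ : SimpleGraph V))).submatrix e e := fun Z hZ =>
    Matrix.map_injective Complex.ofReal_injective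
      (smul_right_injective _ Complex.I_ne_zero (IsPrincipalHamiltonian.unique hZ hS))
  refine ⟨?_, fun d => ⟨μ (E.face d), (hμ _ _).2 rfl, fun v hv => ((hμ _ _).1 hv).symm⟩, ?_⟩
  · obtain ⟨Z, hZ⟩ := WeightedOrientedGraph.exists_skewAdj_eq
      (S := κ • (digraphSkewAdj (lineDigraph (⊤ : SimpleGraph V))).submatrix e e) fun x y => by
        simp only [Matrix.smul_apply, Matrix.submatrix_apply, smul_eq_mul]
        rw [digraphSkewAdj_antisymm]
        ring
    refine ⟨Z, ?_, fun Z' hZ' => WeightedOrientedGraph.skewAdj_injective ?_⟩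
    · change IsPrincipalHamiltonian _ _
      rw [hZ]
      exact hS
    · rw [huniq Z' hZ', hZ]
  · intro Z hZ
    have hZS := huniq Z hZ
    have hadj : ∀ x y, (orientedPart (lineDigraph (⊤ : SimpleGraph V))).Adj (e x) (e y) ↔
        Z.arcs.Adj x y := fun x y => by
      rw [Z.arcs_adj_iff, hZS, ← digraphSkewAdj_pos_iff]
      simp [hκ]
    refine ⟨⟨e, hadj _ _⟩, fun d => ⟨(hμ _ _).2 (he d).1.symm, (he d).2⟩, ⟨κ, hκ, hZS⟩,
      fun x y => ?_⟩
    rw [← hadj]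
    -- Flipping both vertices of the line digraph reverses its arcs, which accounts for the opposite
    -- sign convention.
    change ((e y).snd = (e x).fst ∧ ¬(e x).snd = (e y).fst) ↔
      ((e x).fst = (e y).snd ∧ ¬(e y).fst = (e x).snd)
    rw [eq_comm, eq_comm (a := (e x).snd)]
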